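/- Let \(\Lambda=\mathbb C\setminus[1,+\infty)\) and \(\mathbb H=\{z\in\mathbb C:\operatorname{Im}z>0\}\). Let \(\mathcal T\) be the set of analytic functions \(F\) on \(\Lambda\) of the form \[ F(z)=\int_0^1\frac{d\mu(t)}{1-tz},\qquad z\in\Lambda, \tag{$*$} \] for some Borel probability measure \(\mu\) on \([0,1]\). Let \(F\) be an analytic function on \(\Lambda\) with \(F(0)=1\), and suppose that the restriction of \(F\) to \(\mathbb H\) extends analytically across the slit \((1,+\infty)\) to a function \(F^+\); that is, \(F^+\) is analytic on some open set containing \(\mathbb H\cup(1,+\infty)\) and \(F^+=F\) on \(\mathbb H\). Suppose that the following five conditions hold: 1. \(F(x)\in\mathbb R\) for all \(x\in(-\infty,1)\); 2. \(\limsup_{x\to-\infty}F(x)\ge 0\) (the upper limit being taken in \([-\infty,+\infty]\)); 3. \(\operatorname{Im}F^+(x)\ge 0\) for all \(x\in(1,+\infty)\); 4. \(F(z)=O(|z|^{\alpha})\) as \(z\to\infty\) in \(\mathbb H\), for some real constant \(\alpha<1\); 5. \(F(z)=O(|z-1|^{-\alpha})\) as \(z\to1\) in \(\mathbb H\), for some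 real constant \(\alpha<1\) (not necessarily the same as in 4). Then \(F\in\mathcal T\). Moreover, the limits \[ \alpha_0=\lim_{x\to-\infty}F(x)\qquad\text{and}\qquad \alpha_1=\lim_{x\to1^-}(1-x)F(x) \] exist and are finite and non-negative, and \((*)\) holds for the Borel probability measure \(\mu\) on \([0,1]\) given by \[ d\mu(t)=\alpha_0\,d\delta_0(t)+\alpha_1\,d\delta_1(t)+\frac{\operatorname{Im}F^+(1/t)}{\pi t}\,dt , \] where \(\delta_0\) and \(\delta_1\) are the unit point masses at \(0\) and \(1\), and \(dt\) is Lebesgue measure on \((0,1)\). -/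

import Mathlib

open Set Filter Topology MeasureTheory Asymptotics

noncomputable section

/-- The slit domain `Λ = ℂ ∖ [1, +∞)`. -/
def slitDomain : Set ℂ := ((fun x : ℝ => (x : ℂ)) '' Set.Ici 1)ᶜ

/-- The open upper half-plane `ℍ = {z : 0 < Im z}`, as a set of complex numbers. -/
def upperHalf : Set ℂ := {z : ℂ | 0 < z.im}

/-- `μ` is a Borel probability measure on `[0, 1]` (regarded as a measure on `ℝ` giving no mass to
the complement of `[0, 1]`) and `F z = ∫ dμ(t) / (1 - t z)` for every `z ∈ Λ`. For such `z` the
integrand is bounded and continuous on `[0, 1]`, hence integrable. -/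
structure IsRepresentingMeasure (μ : Measure ℝ) (F : ℂ → ℂ) : Prop where
  isProbabilityMeasure : IsProbabilityMeasure μ
  compl_Icc_eq_zero : μ (Set.Icc (0 : ℝ) 1)ᶜ = 0
  eq_integral : ∀ z ∈ slitDomain, F z = ∫ t in Set.Icc (0 : ℝ) 1, 1 / (1 - (t : ℂ) * z) ∂μ

/-- The class `𝒯` of analytic functions on `Λ` that have a representing probability measure on
`[0, 1]`. Only the values on `Λ` of a function `F : ℂ → ℂ` matter. -/
def classT : Set (ℂ → ℂ) :=
  {F | AnalyticOnNhd ℂ F slitDomain ∧ ∃ μ : Measure ℝ, IsRepresentingMeasure μ F}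

/-- The measure `α₀ δ₀ + α₁ δ₁ + (Im G(1/t) / (π t)) dt` on `[0, 1]`, where `dt` is Lebesgue measure
on `(0, 1)`. It is used for `α₀, α₁ ≥ 0` and `Im G ≥ 0` on `(1, +∞)`. -/
def slitMeasure (α₀ α₁ : ℝ) (G : ℂ → ℂ) : Measure ℝ :=
  ENNReal.ofReal α₀ • Measure.dirac (0 : ℝ) + ENNReal.ofReal α₁ • Measure.dirac (1 : ℝ)
    + (volume.restrict (Set.Ioo (0 : ℝ) 1)).withDensity
        (fun t : ℝ => ENNReal.ofReal ((G ((1 / t : ℝ) : ℂ)).im / (Real.pi * t)))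

end

/-!
On `ℍ` the function `(F z - 1) / z` tends to `0` at infinity, and its boundary values on `ℝ` are
real to the left of `1` and have imaginary part `Im F⁺(x) / x` to the right of it. The growth
conditions bound it by an integrable singularity at `1` and a negative power at infinity, so
Schwarz's formula recovers it from these imaginary parts; after the substitution `x = 1 / t` this
reads `F z = 1 + z ∫ t / (1 - t z) dσ(t)` with `dσ = Im F⁺(1/t) / (π t) dt`, on `ℍ` and hence on
`Λ`.

Consequently `F` is monotone on `(-∞, 1)`, so the condition on the upper limit says that `F ≥ 0`
there, and Fatou's lemma as `x → -∞` gives `σ(0, 1) ≤ 1`. Since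
`1 + t z / (1 - t z) = 1 / (1 - t z)`, putting the missing mass `1 - σ(0, 1)` at `0` turns `σ` into
a representing probability measure. The two limits are the masses of this measure at `0` and `1`;
in particular `α₁ = 0`.
-/

open scoped ComplexConjugate

/-! ### Boundary values on the upper half-plane -/

/-- `h` is holomorphic on the upper half-plane, its vertical limits at the real line are `κ`, and
its restrictions to horizontal lines close to the real line are dominated by `g`; if `g` is
integrable, integrals of `h` along these lines converge to the integral of `κ`. -/
structure HasDominatedBoundaryValues (h : ℂ → ℂ) (κ : ℝ → ℂ) (g : ℝ → ℝ) : Prop where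
  differentiableOn : DifferentiableOn ℂ h upperHalf
  norm_le : ∀ᶠ y : ℝ in 𝓝[>] 0, ∀ᵐ x : ℝ, ‖h (x + y * Complex.I)‖ ≤ g x
  tendsto : ∀ᵐ x : ℝ, Tendsto (fun y : ℝ => h (x + y * Complex.I)) (𝓝[>] 0) (𝓝 (κ x))

theorem isOpen_upperHalf : IsOpen upperHalf := isOpen_lt continuous_const Complex.continuous_im

theorem norm_integral_rect_bottom_le {k : ℂ → ℂ} {n c : ℝ} (hn : 1 < n)
    (hk : DifferentiableOn ℂ k upperHalf) (hc : ∀ w ∈ upperHalf, n ≤ ‖w‖ → ‖k w‖ ≤ c) :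
    ‖∫ x in (-n)..n, k (x + (n⁻¹ : ℝ) * Complex.I)‖ ≤ 4 * (c * n) := by
  have hn0 : 0 < n := one_pos.trans hn
  have hninv : 0 < n⁻¹ := inv_pos.2 hn0
  have hninv_le : n⁻¹ ≤ n := (inv_le_one_of_one_le₀ hn.le).trans hn.le
  have hc0 : 0 ≤ c :=
    (norm_nonneg _).trans (hc (n * Complex.I) (by simpa [upperHalf] using hn0)
      (by simp [le_abs_self]))
  have hrect := Complex.integral_boundary_rect_eq_zero_of_differentiableOn k
    (⟨-n, n⁻¹⟩ : ℂ) (⟨n, n⟩ : ℂ) (hk.mono fun w hw => hninv.trans_le <| by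
      simpa [hninv_le] using (uIcc_of_le hninv_le ▸ hw.2 : w.im ∈ Icc n⁻¹ n).1)
  have htop : ‖∫ x : ℝ in (-n)..n, k (x + n * Complex.I)‖ ≤ c * (2 * n) := by
    refine (intervalIntegral.norm_integral_le_of_norm_le_const fun x _ => hc _ ?_ ?_).trans_eq ?_
    · simpa [upperHalf] using hn0
    · simpa [abs_of_pos hn0] using Complex.abs_im_le_norm (x + n * Complex.I)
    · rw [abs_of_pos (by linarith)]; ring
  have hside : ∀ a : ℝ, |a| = n → ‖∫ y : ℝ in n⁻¹..n, k (a + y * Complex.I)‖ ≤ c * n := by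
    intro a ha
    refine (intervalIntegral.norm_integral_le_of_norm_le_const fun y hy => hc _ ?_ ?_).trans ?_
    · rw [uIoc_of_le hninv_le] at hy
      simpa [upperHalf] using hninv.trans hy.1
    · simpa [ha] using Complex.abs_re_le_norm (a + y * Complex.I)
    · gcongr
      rw [abs_of_nonneg (by linarith)]
      linarith
  have hleft := hside (-n) (by rw [abs_neg, abs_of_pos hn0])
  have hright := hside n (abs_of_pos hn0)
  simp only [smul_eq_mul] at hrect
  calc ‖∫ x in (-n)..n, k (x + (n⁻¹ : ℝ) * Complex.I)‖
      = ‖(∫ x in (-n)..n, k (x + n * Complex.I))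
          - Complex.I * (∫ y in n⁻¹..n, k (n + y * Complex.I))
          + Complex.I * ∫ y in n⁻¹..n, k ((-n : ℝ) + y * Complex.I)‖ := by
        congr 1; linear_combination hrect
    _ ≤ c * (2 * n) + c * n + c * n := by
        refine (norm_add_le _ _).trans (add_le_add ((norm_sub_le _ _).trans ?_) ?_)
        · simpa using add_le_add htop hright
        · simpa using hleft
    _ = 4 * (c * n) := by ring

theorem tendsto_integral_rect_bottom {k : ℂ → ℂ} (hk : DifferentiableOn ℂ k upperHalf)
    (hdecay : k =o[Bornology.cobounded ℂ ⊓ 𝓟 upperHalf] (fun w => ‖w‖⁻¹)) :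
    Tendsto (fun n : ℝ => ∫ x in (-n)..n, k (x + (n⁻¹ : ℝ) * Complex.I)) atTop (𝓝 0) := by
  rw [Metric.tendsto_nhds]
  intro ε hε
  have hd := hdecay.def (show 0 < ε / 8 by positivity)
  rw [eventually_inf_principal, ← comap_norm_atTop, eventually_comap] at hd
  obtain ⟨R, hR⟩ := eventually_atTop.1 hd
  filter_upwards [eventually_ge_atTop R, eventually_gt_atTop 1] with n hnR hn1
  have hbound : ∀ w ∈ upperHalf, n ≤ ‖w‖ → ‖k w‖ ≤ ε / 8 * n⁻¹ := by
    intro w hw hwn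
    refine (hR ‖w‖ (hnR.trans hwn) w rfl hw).trans ?_
    rw [norm_inv, norm_norm]
    gcongr
  rw [dist_zero_right]
  calc _ ≤ 4 * (ε / 8 * n⁻¹ * n) := norm_integral_rect_bottom_le hn1 hk hbound
    _ = ε / 2 := by field_simp; norm_num
    _ < ε := half_lt_self hε

theorem exists_one_add_abs_le_mul_norm_sub {ζ : ℂ} (hζ : ζ.im ≠ 0) :
    ∃ K : ℝ, ∀ᶠ y : ℝ in 𝓝 0, ∀ x : ℝ, 1 + |x| ≤ K * ‖x + y * Complex.I - ζ‖ := by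
  have hpos : 0 < |ζ.im| / 2 := by positivity
  refine ⟨(1 + |ζ.re|) / (|ζ.im| / 2) + 1, ?_⟩
  filter_upwards [Metric.ball_mem_nhds (0 : ℝ) hpos] with y hy x
  rw [mem_ball_zero_iff, Real.norm_eq_abs] at hy
  have him : |ζ.im| / 2 ≤ ‖x + y * Complex.I - ζ‖ := by
    have hle : |y - ζ.im| ≤ ‖x + y * Complex.I - ζ‖ := by
      simpa using Complex.abs_im_le_norm (x + y * Complex.I - ζ)
    have := abs_sub_abs_le_abs_sub ζ.im y
    rw [abs_sub_comm] at this
    linarith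
  have hre : |x| ≤ |ζ.re| + ‖x + y * Complex.I - ζ‖ := by
    have hle : |x - ζ.re| ≤ ‖x + y * Complex.I - ζ‖ := by
      simpa using Complex.abs_re_le_norm (x + y * Complex.I - ζ)
    linarith [abs_sub_abs_le_abs_sub x ζ.re]
  have : 1 + |ζ.re| ≤ (1 + |ζ.re|) / (|ζ.im| / 2) * ‖x + y * Complex.I - ζ‖ := by
    rw [div_mul_eq_mul_div, le_div_iff₀ hpos]
    gcongr
  linarith

theorem norm_div_le_mul_div {a b : ℂ} {M K r : ℝ} (hr : 0 < r) (ha : ‖a‖ ≤ M)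
    (hb : r ≤ K * ‖b‖) : ‖a / b‖ ≤ K * (M / r) := by
  have hM : 0 ≤ M / r := div_nonneg ((norm_nonneg a).trans ha) hr.le
  have hb0 : 0 < ‖b‖ := (norm_nonneg b).lt_of_ne fun h => by rw [← h, mul_zero] at hb; linarith
  rw [norm_div, div_le_iff₀ hb0]
  calc ‖a‖ ≤ M / r * r := by rwa [div_mul_cancel₀ _ hr.ne']
    _ ≤ M / r * (K * ‖b‖) := by gcongr
    _ = K * (M / r) * ‖b‖ := by ring

theorem tendsto_ofReal_add_mul_I (x : ℝ) :
    Tendsto (fun y : ℝ => (x : ℂ) + y * Complex.I) (𝓝[>] 0) (𝓝 (x : ℂ)) := by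
  have : ContinuousAt (fun y : ℝ => (x : ℂ) + y * Complex.I) 0 := by fun_prop
  simpa [ContinuousAt] using this.tendsto.mono_left nhdsWithin_le_nhds

theorem dslope_eq_div {h : ℂ → ℂ} {z w : ℂ} (hw : w ≠ z) :
    dslope h z w = (h w - h z) / (w - z) := by
  rw [dslope_of_ne _ hw, slope_def_field]

theorem isBigO_inv_sub_cobounded (ζ : ℂ) :
    (fun w : ℂ => (w - ζ)⁻¹) =O[Bornology.cobounded ℂ] (fun w => ‖w‖⁻¹) := by
  refine IsBigO.of_bound 2 ?_
  filter_upwards [tendsto_norm_cobounded_atTop.eventually (eventually_ge_atTop (2 * ‖ζ‖ + 1))]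
    with w hw
  have hle : ‖w‖ / 2 ≤ ‖w - ζ‖ := by linarith [norm_sub_norm_le w ζ, norm_nonneg ζ]
  rw [norm_inv, norm_inv, norm_norm]
  calc ‖w - ζ‖⁻¹ ≤ (‖w‖ / 2)⁻¹ := inv_anti₀ (by linarith [norm_nonneg ζ]) hle
    _ = 2 * ‖w‖⁻¹ := by rw [inv_div, div_eq_mul_inv]

theorem tendsto_dslope_cobounded {h : ℂ → ℂ} {S : Set ℂ} (z : ℂ)
    (hdecay : h =o[Bornology.cobounded ℂ ⊓ 𝓟 S] fun w => ‖w‖) :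
    Tendsto (dslope h z) (Bornology.cobounded ℂ ⊓ 𝓟 S) (𝓝 0) := by
  have hnum : (fun w => h w - h z) =o[Bornology.cobounded ℂ ⊓ 𝓟 S] fun w => ‖w‖ := by
    refine hdecay.sub (isLittleO_const_left.2 (Or.inr ?_))
    simpa [Function.comp_def] using tendsto_norm_cobounded_atTop.mono_left inf_le_left
  have hfar : ∀ᶠ w : ℂ in Bornology.cobounded ℂ ⊓ 𝓟 S, w ≠ z ∧ w ≠ 0 :=
    ((Bornology.eventually_ne_cobounded z).and
      (Bornology.eventually_ne_cobounded 0)).filter_mono inf_le_left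
  refine (isLittleO_one_iff ℝ).1 ((hnum.mul_isBigO
    ((isBigO_inv_sub_cobounded z).mono inf_le_left)).congr' ?_ ?_)
  · filter_upwards [hfar] with w hw
    rw [dslope_eq_div hw.1, div_eq_mul_inv]
  · filter_upwards [hfar] with w hw
    exact mul_inv_cancel₀ (norm_ne_zero_iff.2 hw.2)

theorem sub_mul_sub_conj (x : ℝ) (z : ℂ) :
    ((x : ℂ) - z) * (x - conj z) = ((x - z.re) ^ 2 + z.im ^ 2 : ℝ) := by
  rw [← Complex.conj_ofReal x, ← map_sub, Complex.conj_ofReal, Complex.mul_conj,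
    Complex.normSq_apply]
  simp [sq]

theorem integral_inv_sub_mul_sub_conj {z : ℂ} (hz : 0 < z.im) :
    Integrable (fun x : ℝ => (((x : ℂ) - z) * (x - conj z))⁻¹) ∧
      ∫ x : ℝ, (((x : ℂ) - z) * (x - conj z))⁻¹ = Real.pi / z.im := by
  lift z.im to NNReal using hz.le with γ hγ
  have hpdf : ∀ x : ℝ, (((x : ℂ) - z) * (x - conj z))⁻¹ =
      (Real.pi / γ * ProbabilityTheory.cauchyPDFReal z.re γ x : ℝ) := fun x => by
    rw [sub_mul_sub_conj, ProbabilityTheory.cauchyPDFReal_def, ← hγ, ← Complex.ofReal_inv]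
    congr 1
    have : (γ:ℝ) ≠ 0 := hz.ne'
    field_simp
  simp_rw [hpdf]
  refine ⟨((ProbabilityTheory.integrable_cauchyPDFReal _).const_mul _).ofReal, ?_⟩
  rw [integral_complex_ofReal, integral_const_mul,
    ProbabilityTheory.integral_cauchyPDFReal_eq_one _ (by exact_mod_cast hz.ne')]
  simp

theorem ofReal_sub_ne_zero {z : ℂ} (hz : z.im ≠ 0) (x : ℝ) : (x : ℂ) - z ≠ 0 :=
  sub_ne_zero.2 fun h => hz (by simp [← h])

theorem im_div_sub_eq {z : ℂ} (hz : z.im ≠ 0) (w : ℂ) (x : ℝ) :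
    (w.im : ℂ) / (x - z) =
      z.im * (w / ((x - z) * (x - conj z))) + ((w / (x - conj z)).im : ℂ) := by
  have hne := ofReal_sub_ne_zero hz x
  have hne' := ofReal_sub_ne_zero (z := conj z) (by simpa using hz) x
  simp only [Complex.im_eq_sub_conj, map_div₀, map_sub, Complex.conj_ofReal, Complex.conj_conj]
  field_simp
  ring

namespace HasDominatedBoundaryValues

variable {h : ℂ → ℂ} {κ : ℝ → ℂ} {g : ℝ → ℝ}

theorem continuous_horizontal (H : HasDominatedBoundaryValues h κ g) {y : ℝ} (hy : 0 < y) :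
    Continuous fun x : ℝ => h (x + y * Complex.I) :=
  H.differentiableOn.continuousOn.comp_continuous (by fun_prop)
    fun x => by simpa [upperHalf] using hy

theorem tendsto_indicator (H : HasDominatedBoundaryValues h κ g) :
    ∀ᵐ x : ℝ, Tendsto (fun n : ℝ => (Ioc (-n) n).indicator
      (fun x : ℝ => h (x + (n⁻¹ : ℝ) * Complex.I)) x) atTop (𝓝 (κ x)) := by
  filter_upwards [H.tendsto] with x hx
  refine (hx.comp tendsto_inv_atTop_nhdsGT_zero).congr' ?_
  filter_upwards [eventually_gt_atTop |x|] with n hn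
  have hmem : x ∈ Ioc (-n) n := ⟨(abs_lt.1 hn).1, (abs_lt.1 hn).2.le⟩
  rw [indicator_of_mem hmem, Function.comp_apply]

theorem integrable_boundary (H : HasDominatedBoundaryValues h κ g) (hg : Integrable g) :
    Integrable κ := by
  have hinv : Tendsto (fun n : ℕ => ((n : ℝ) + 1)⁻¹) atTop (𝓝[>] 0) :=
    tendsto_inv_atTop_nhdsGT_zero.comp
      (tendsto_atTop_add_const_right _ 1 tendsto_natCast_atTop_atTop)
  have hle : ∀ᵐ x : ℝ, ∀ᶠ n : ℕ in atTop, ‖h (x + (((n : ℝ) + 1)⁻¹ : ℝ) * Complex.I)‖ ≤ g x := by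
    obtain ⟨N, hN⟩ := eventually_atTop.1 (hinv.eventually H.norm_le)
    filter_upwards [ae_all_iff.2 fun n => eventually_imp_distrib_left.2 (hN n)] with x hx
    exact eventually_atTop.2 ⟨N, hx⟩
  refine hg.mono' (aestronglyMeasurable_of_tendsto_ae atTop
    (f := fun (n : ℕ) (x : ℝ) => h (x + (((n : ℝ) + 1)⁻¹ : ℝ) * Complex.I))
    (fun n => (H.continuous_horizontal (by positivity)).aestronglyMeasurable)
    (H.tendsto.mono fun x hx => hx.comp hinv)) ?_
  filter_upwards [H.tendsto, hle] with x hx hxle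
  exact le_of_tendsto (hx.comp hinv).norm hxle

/-- Cauchy's theorem for the upper half-plane. -/
theorem integral_boundary_eq_zero (H : HasDominatedBoundaryValues h κ g) (hg : Integrable g)
    (hdecay : h =o[Bornology.cobounded ℂ ⊓ 𝓟 upperHalf] (fun w => ‖w‖⁻¹)) :
    ∫ x, κ x = 0 := by
  have hinv : Tendsto (fun n : ℝ => n⁻¹) atTop (𝓝[>] 0) := tendsto_inv_atTop_nhdsGT_zero
  have hlim : Tendsto (fun n : ℝ => ∫ x, (Ioc (-n) n).indicator
      (fun x : ℝ => h (x + (n⁻¹ : ℝ) * Complex.I)) x) atTop (𝓝 (∫ x, κ x)) := by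
    refine tendsto_integral_filter_of_dominated_convergence g ?_ ?_ hg H.tendsto_indicator
    · filter_upwards [eventually_gt_atTop 0] with n hn
      exact (H.continuous_horizontal (inv_pos.2 hn)).aestronglyMeasurable.indicator
        measurableSet_Ioc
    · filter_upwards [hinv.eventually H.norm_le] with n hn
      filter_upwards [hn] with x hx
      exact (norm_indicator_le_norm_self _ _).trans hx
  refine tendsto_nhds_unique hlim
    ((tendsto_integral_rect_bottom H.differentiableOn hdecay).congr' ?_)
  filter_upwards [eventually_gt_atTop 0] with n hn
  rw [integral_indicator measurableSet_Ioc, intervalIntegral.integral_of_le (by linarith)]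

theorem div_sub (H : HasDominatedBoundaryValues h κ g) {ζ : ℂ} (hζ : ζ.im < 0) :
    ∃ K : ℝ, HasDominatedBoundaryValues (fun w => h w / (w - ζ)) (fun x => κ x / (x - ζ))
      (fun x => K * (g x / (1 + |x|))) := by
  have hne : ∀ w : ℂ, 0 ≤ w.im → w - ζ ≠ 0 := fun w hw h0 => by
    rw [sub_eq_zero.1 h0] at hw
    linarith
  obtain ⟨K, hK⟩ := exists_one_add_abs_le_mul_norm_sub hζ.ne
  refine ⟨K, H.differentiableOn.div (by fun_prop) fun w hw => hne w (le_of_lt hw), ?_, ?_⟩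
  · filter_upwards [H.norm_le, hK.filter_mono nhdsWithin_le_nhds] with y hy hyK
    filter_upwards [hy] with x hx
    exact norm_div_le_mul_div (by positivity) hx (hyK x)
  · filter_upwards [H.tendsto] with x hx
    exact hx.div ((tendsto_ofReal_add_mul_I x).sub_const ζ) (hne x (by simp))

theorem dslope (H : HasDominatedBoundaryValues h κ g) {z : ℂ} (hz : z ∈ upperHalf) :
    ∃ K : ℝ, HasDominatedBoundaryValues (dslope h z) (fun x => (κ x - h z) / (x - z))
      (fun x => K * ((g x + ‖h z‖) / (1 + |x|))) := by
  have hz0 : 0 < z.im := hz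
  have hslope : ∀ᶠ y : ℝ in 𝓝[>] 0, ∀ x : ℝ, _root_.dslope h z (x + y * Complex.I) =
      (h (x + y * Complex.I) - h z) / (x + y * Complex.I - z) := by
    filter_upwards [Ioo_mem_nhdsGT hz0] with y hy x
    exact dslope_eq_div fun h => hy.2.ne (by simpa using congrArg Complex.im h)
  obtain ⟨K, hK⟩ := exists_one_add_abs_le_mul_norm_sub hz0.ne'
  refine ⟨K, ?_, ?_, ?_⟩
  · exact (Complex.differentiableOn_dslope (isOpen_upperHalf.mem_nhds hz)).2 H.differentiableOn
  · filter_upwards [H.norm_le, hK.filter_mono nhdsWithin_le_nhds, hslope] with y hy hyK hys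
    filter_upwards [hy] with x hx
    rw [hys]
    exact norm_div_le_mul_div (by positivity)
      ((norm_sub_le _ _).trans (add_le_add_left hx _)) (hyK x)
  · filter_upwards [H.tendsto] with x hx
    exact ((hx.sub_const (h z)).div ((tendsto_ofReal_add_mul_I x).sub_const z)
      (ofReal_sub_ne_zero hz0.ne' x)).congr' (hslope.mono fun y hy => (hy x).symm)

/-- Cauchy's integral formula for the upper half-plane, at a point outside of its closure. -/
theorem cauchy (H : HasDominatedBoundaryValues h κ g) (hg : Integrable fun x => g x / (1 + |x|))
    (hdecay : Tendsto h (Bornology.cobounded ℂ ⊓ 𝓟 upperHalf) (𝓝 0)) {ζ : ℂ} (hζ : ζ.im < 0) :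
    Integrable (fun x : ℝ => κ x / (x - ζ)) ∧ ∫ x : ℝ, κ x / (x - ζ) = 0 := by
  obtain ⟨K, HK⟩ := H.div_sub hζ
  refine ⟨HK.integrable_boundary (hg.const_mul K),
    HK.integral_boundary_eq_zero (hg.const_mul K) ?_⟩
  simpa [div_eq_mul_inv] using ((isLittleO_one_iff ℝ).2 hdecay).mul_isBigO
    ((isBigO_inv_sub_cobounded ζ).mono inf_le_left)

/-- Poisson's formula. It is Cauchy's formula for `dslope h z` at the reflected point `conj z`. -/
theorem poisson (H : HasDominatedBoundaryValues h κ g)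
    (hg : Integrable fun x => g x / (1 + |x|) / (1 + |x|))
    (hdecay : h =o[Bornology.cobounded ℂ ⊓ 𝓟 upperHalf] fun w => ‖w‖) {z : ℂ}
    (hz : z ∈ upperHalf) :
    Integrable (fun x : ℝ => κ x / ((x - z) * (x - conj z))) ∧
      ∫ x : ℝ, κ x / ((x - z) * (x - conj z)) = Real.pi / z.im * h z := by
  obtain ⟨hkernel, hkernel_eq⟩ := integral_inv_sub_mul_sub_conj hz
  have hsq : Integrable fun x : ℝ => ‖h z‖ / (1 + |x|) / (1 + |x|) := by
    have := (integrable_one_add_norm (E := ℝ) (μ := volume) (r := 2) (by simp)).const_mul ‖h z‖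
    refine this.congr (Eventually.of_forall fun x => ?_)
    have : 0 < 1 + |x| := by positivity
    simp only [Real.norm_eq_abs, Real.rpow_neg this.le, Real.rpow_two]
    field_simp
  obtain ⟨K, HK⟩ := H.dslope hz
  obtain ⟨hint, hzero⟩ := HK.cauchy (ζ := conj z)
    (((hg.add hsq).const_mul K).congr (Eventually.of_forall fun x => by
      simp only [Pi.add_apply]; ring))
    (tendsto_dslope_cobounded z hdecay) (by simpa [upperHalf] using hz)
  have hdecomp : ∀ x : ℝ, κ x / ((x - z) * (x - conj z)) =
      (κ x - h z) / (x - z) / (x - conj z) + h z * ((x - z) * (x - conj z))⁻¹ := fun x => by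
    rw [div_div]; ring
  simp_rw [hdecomp]
  refine ⟨hint.add (hkernel.const_mul _), ?_⟩
  rw [integral_add hint (hkernel.const_mul _), integral_const_mul, hzero, hkernel_eq, zero_add,
    mul_comm]

/-- Schwarz's formula. It combines Poisson's formula with Cauchy's formula at `conj z`. -/
theorem schwarz (H : HasDominatedBoundaryValues h κ g)
    (hg : Integrable fun x => g x / (1 + |x|))
    (hdecay : Tendsto h (Bornology.cobounded ℂ ⊓ 𝓟 upperHalf) (𝓝 0)) {z : ℂ}
    (hz : z ∈ upperHalf) :
    Integrable (fun x : ℝ => ((κ x).im : ℂ) / (x - z)) ∧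
      ∫ x : ℝ, ((κ x).im : ℂ) / (x - z) = Real.pi * h z := by
  have hzim : 0 < z.im := hz
  have hg2 : Integrable fun x => g x / (1 + |x|) / (1 + |x|) := by
    refine (hg.mul_bdd (c := 1) (g := fun x => (1 + |x|)⁻¹) (by fun_prop) ?_).congr ?_
    · refine Eventually.of_forall fun x => ?_
      rw [norm_inv, Real.norm_of_nonneg (by positivity)]
      exact inv_le_one_of_one_le₀ (by simp)
    · exact Eventually.of_forall fun x => (div_eq_mul_inv _ _).symm
  have hlin : h =o[Bornology.cobounded ℂ ⊓ 𝓟 upperHalf] fun w => ‖w‖ :=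
    ((isLittleO_one_iff ℝ).2 hdecay).trans_isBigO <| IsBigO.of_bound 1 <|
      (tendsto_norm_cobounded_atTop.eventually_ge_atTop 1).filter_mono inf_le_left |>.mono
        fun w hw => by simpa using hw
  obtain ⟨hpoisson, hpoisson_eq⟩ := H.poisson hg2 hlin hz
  obtain ⟨hcauchy, hcauchy_eq⟩ := H.cauchy hg hdecay (ζ := conj z) (by simpa using hzim)
  have hcauchy_im : Integrable fun x : ℝ => ((κ x / (x - conj z)).im : ℂ) := hcauchy.im.ofReal
  have hcauchy_im_eq : ∫ x : ℝ, ((κ x / (x - conj z)).im : ℂ) = 0 := by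
    have := integral_im hcauchy
    rw [hcauchy_eq, map_zero] at this
    rw [integral_complex_ofReal]
    exact_mod_cast this
  simp_rw [im_div_sub_eq hzim.ne']
  refine ⟨(hpoisson.const_mul _).add hcauchy_im, ?_⟩
  rw [integral_add (hpoisson.const_mul _) hcauchy_im, integral_const_mul, hpoisson_eq,
    hcauchy_im_eq, add_zero, ← mul_assoc,
    mul_div_cancel₀ _ (Complex.ofReal_ne_zero.2 hzim.ne')]

end HasDominatedBoundaryValues

/-! ### Growth of `(F w - 1) / w` on the upper half-plane -/

theorem isBigO_principal_of_forall_nhdsWithin {X E E' : Type*} [TopologicalSpace X] [Norm E]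
    [SeminormedAddCommGroup E'] {S : Set X} {f : X → E} {g : X → E'}
    (hinf : f =O[cocompact X ⊓ 𝓟 S] g) (hloc : ∀ p, f =O[𝓝[S] p] g) : f =O[𝓟 S] g := by
  obtain ⟨c, hc⟩ := hinf.bound
  rw [eventually_inf_principal, Filter.Eventually, mem_cocompact] at hc
  obtain ⟨K, hK, hKc⟩ := hc
  have hcompact : f =O[𝓟 (K ∩ S)] g := by
    refine hK.induction_on (p := fun t => f =O[𝓟 (t ∩ S)] g) ?_ ?_ ?_ ?_
    · simp only [empty_inter, principal_empty, isBigO_bot]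
    · exact fun s t hst ht => ht.mono (principal_mono.2 (inter_subset_inter_left _ hst))
    · intro s t hs ht
      rw [union_inter_distrib_right, ← sup_principal]
      exact hs.sup ht
    · intro p _
      obtain ⟨c, hc⟩ := (hloc p).bound
      rw [eventually_nhdsWithin_iff] at hc
      exact ⟨_, mem_nhdsWithin_of_mem_nhds hc, isBigO_principal.2 ⟨c, fun y hy => hy.1 hy.2⟩⟩
  have hfar : f =O[𝓟 (Kᶜ ∩ S)] g := isBigO_principal.2 ⟨c, fun y hy => hKc hy.1 hy.2⟩
  have := hcompact.sup hfar
  rwa [sup_principal, ← union_inter_distrib_right, union_compl_self, univ_inter] at this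

theorem isBigO_norm_rpow_cobounded {c a : ℝ} (hca : c ≤ a) :
    (fun w : ℂ => ‖w‖ ^ c) =O[Bornology.cobounded ℂ] fun w => ‖w‖ ^ a := by
  refine IsBigO.of_bound 1 ?_
  filter_upwards [tendsto_norm_cobounded_atTop.eventually_ge_atTop 1] with w hw
  rw [Real.norm_of_nonneg (by positivity), Real.norm_of_nonneg (by positivity), one_mul]
  exact Real.rpow_le_rpow_of_exponent_le hw hca

theorem isBigO_norm_sub_rpow_nhdsNE {c a : ℝ} (hca : c ≤ a) (p : ℂ) :
    (fun w : ℂ => ‖w - p‖ ^ (-c)) =O[𝓝[≠] p] fun w => ‖w - p‖ ^ (-a) := by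
  refine IsBigO.of_bound 1 ?_
  filter_upwards [self_mem_nhdsWithin,
    mem_nhdsWithin_of_mem_nhds (Metric.closedBall_mem_nhds p one_pos)] with w hw hw1
  rw [Real.norm_of_nonneg (by positivity), Real.norm_of_nonneg (by positivity), one_mul]
  exact Real.rpow_le_rpow_of_exponent_ge (norm_pos_iff.2 (sub_ne_zero.2 hw))
    (mem_closedBall_iff_norm.1 hw1) (neg_le_neg hca)

/-- The weight dominating `(F w - 1) / w` on the upper half-plane: its singularity at `1` is
integrable for `b < 1`, and for `0 < s` it has the decay at infinity that Schwarz's formula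
asks for. -/
noncomputable def growthWeight (b s : ℝ) (w : ℂ) : ℝ := ‖w - 1‖ ^ (-b) + (1 + ‖w‖) ^ (-s)

section growthWeight

variable {b s : ℝ}

theorem rpow_norm_sub_one_le_growthWeight (w : ℂ) : ‖w - 1‖ ^ (-b) ≤ growthWeight b s w :=
  le_add_of_nonneg_right (by positivity)

theorem rpow_one_add_norm_le_growthWeight (w : ℂ) : (1 + ‖w‖) ^ (-s) ≤ growthWeight b s w :=
  le_add_of_nonneg_left (by positivity)

theorem growthWeight_nonneg (w : ℂ) : 0 ≤ growthWeight b s w := by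
  unfold growthWeight
  positivity

theorem growthWeight_le_growthWeight_re (hb : 0 ≤ b) (hs : 0 ≤ s) {w : ℂ} (hw : w.re ≠ 1) :
    growthWeight b s w ≤ growthWeight b s (w.re : ℂ) := by
  have hsub : ‖(w.re : ℂ) - 1‖ ≤ ‖w - 1‖ := by
    rw [← Complex.ofReal_one, ← Complex.ofReal_sub, Complex.norm_real]
    exact Complex.abs_re_le_norm (w - 1)
  have hpos : 0 < ‖(w.re : ℂ) - 1‖ := norm_pos_iff.2 (sub_ne_zero.2 (by exact_mod_cast hw))
  have hre : ‖(w.re : ℂ)‖ ≤ ‖w‖ := by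
    rw [Complex.norm_real]
    exact Complex.abs_re_le_norm w
  exact add_le_add (Real.rpow_le_rpow_of_nonpos hpos hsub (neg_nonpos.2 hb))
    (Real.rpow_le_rpow_of_nonpos (by positivity) (by gcongr) (neg_nonpos.2 hs))

theorem isBigO_one_growthWeight_nhds (p : ℂ) :
    (fun _ => (1 : ℝ)) =O[𝓝 p] growthWeight b s := by
  have hcont : ContinuousAt (fun w : ℂ => (1 + ‖w‖) ^ s) p :=
    ContinuousAt.rpow_const (by fun_prop) (Or.inl (by positivity))
  refine ((hcont.tendsto.isBigO_one ℝ).mul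
    (isBigO_refl (fun w : ℂ => (1 + ‖w‖) ^ (-s)) (𝓝 p))).congr_left (fun w => ?_) |>.trans ?_
  · rw [← Real.rpow_add (by positivity), add_neg_cancel, Real.rpow_zero]
  · refine IsBigO.of_bound' (Eventually.of_forall fun w => ?_)
    rw [one_mul, Real.norm_of_nonneg (by positivity), Real.norm_of_nonneg (growthWeight_nonneg w)]
    exact rpow_one_add_norm_le_growthWeight w

theorem isBigO_norm_rpow_growthWeight_cobounded (hs : 0 ≤ s) :
    (fun w => ‖w‖ ^ (-s)) =O[Bornology.cobounded ℂ] growthWeight b s := by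
  refine IsBigO.of_bound (2 ^ s) ?_
  filter_upwards [tendsto_norm_cobounded_atTop.eventually_ge_atTop 1] with w hw
  have hw0 : 0 < ‖w‖ := one_pos.trans_le hw
  rw [Real.norm_of_nonneg (by positivity), Real.norm_of_nonneg (growthWeight_nonneg w)]
  calc ‖w‖ ^ (-s) = 2 ^ s * (2 * ‖w‖) ^ (-s) := by
        rw [Real.mul_rpow two_pos.le hw0.le, ← mul_assoc, ← Real.rpow_add two_pos, add_neg_cancel,
          Real.rpow_zero, one_mul]
    _ ≤ 2 ^ s * (1 + ‖w‖) ^ (-s) := by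
        gcongr ?_ * ?_
        exact Real.rpow_le_rpow_of_nonpos (by positivity) (by linarith) (neg_nonpos.2 hs)
    _ ≤ 2 ^ s * growthWeight b s w := by
        gcongr
        exact rpow_one_add_norm_le_growthWeight w

theorem tendsto_growthWeight_cobounded (hb : 0 < b) (hs : 0 < s) :
    Tendsto (growthWeight b s) (Bornology.cobounded ℂ) (𝓝 0) := by
  have hsub : Tendsto (fun w : ℂ => ‖w - 1‖) (Bornology.cobounded ℂ) atTop :=
    tendsto_atTop_mono (fun w => by simpa using norm_sub_norm_le w 1)
      (tendsto_atTop_add_const_right _ (-1) tendsto_norm_cobounded_atTop)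
  have hadd : Tendsto (fun w : ℂ => 1 + ‖w‖) (Bornology.cobounded ℂ) atTop :=
    tendsto_atTop_add_const_left _ 1 tendsto_norm_cobounded_atTop
  have hsum := ((tendsto_rpow_neg_atTop hb).comp hsub).add ((tendsto_rpow_neg_atTop hs).comp hadd)
  rw [add_zero] at hsum
  exact hsum

theorem integrableOn_Ioi_rpow_neg_div_one_add (hb : 0 < b) (hb1 : b < 1) :
    IntegrableOn (fun u : ℝ => u ^ (-b) / (1 + u)) (Ioi 0) := by
  have hmeas : Measurable fun u : ℝ => u ^ (-b) / (1 + u) := by fun_prop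
  rw [← Ioc_union_Ioi_eq_Ioi zero_le_one]
  refine IntegrableOn.union ?_ ?_
  · refine (intervalIntegral.intervalIntegrable_rpow' (a := 0) (b := 1) (r := -b)
      (by linarith)).1.mono' hmeas.aestronglyMeasurable ?_
    filter_upwards [ae_restrict_mem measurableSet_Ioc] with u hu
    have hu0 := hu.1
    rw [Real.norm_of_nonneg (by positivity)]
    exact div_le_self (by positivity) (by linarith)
  · refine (integrableOn_Ioi_rpow_of_lt (a := -b - 1) (c := 1) (by linarith) one_pos).mono'
      hmeas.aestronglyMeasurable ?_
    filter_upwards [ae_restrict_mem measurableSet_Ioi] with u hu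
    have hu0 : 0 < u := one_pos.trans hu
    rw [Real.norm_of_nonneg (by positivity), Real.rpow_sub hu0, Real.rpow_one]
    gcongr
    linarith

theorem integrable_rpow_abs_sub_div (hb : 0 < b) (hb1 : b < 1) (c : ℝ) :
    Integrable fun x : ℝ => |x - c| ^ (-b) / (1 + |x|) := by
  have hcentred : Integrable fun u : ℝ => |u| ^ (-b) / (1 + |u|) := by
    simpa using (integrable_fun_norm_addHaar (E := ℝ) volume
      (f := fun u : ℝ => u ^ (-b) / (1 + u))).2
      (by simpa using integrableOn_Ioi_rpow_neg_div_one_add hb hb1)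
  refine ((hcentred.comp_sub_right c).const_mul (1 + |c|)).mono'
    (Measurable.aestronglyMeasurable (by fun_prop)) (Eventually.of_forall fun x => ?_)
  have hshift : 1 + |x - c| ≤ (1 + |c|) * (1 + |x|) := by
    nlinarith [abs_sub x c, abs_nonneg x, abs_nonneg c]
  rw [Real.norm_of_nonneg (by positivity), ← mul_div_assoc,
    div_le_div_iff₀ (by positivity) (by positivity)]
  calc |x - c| ^ (-b) * (1 + |x - c|) ≤ |x - c| ^ (-b) * ((1 + |c|) * (1 + |x|)) := by gcongr
    _ = (1 + |c|) * |x - c| ^ (-b) * (1 + |x|) := by ring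

theorem integrable_growthWeight_div (hb : 0 < b) (hb1 : b < 1) (hs : 0 < s) :
    Integrable fun x : ℝ => growthWeight b s (x : ℂ) / (1 + |x|) := by
  have htail := integrable_one_add_norm (E := ℝ) (μ := volume) (r := s + 1) (by simpa using hs)
  refine ((integrable_rpow_abs_sub_div hb hb1 1).add htail).congr
    (Eventually.of_forall fun x => ?_)
  have hpos : 0 < 1 + |x| := by positivity
  have hnorm : ‖(x : ℂ) - 1‖ = |x - 1| := by
    rw [← Complex.ofReal_one, ← Complex.ofReal_sub, Complex.norm_real, Real.norm_eq_abs]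
  simp only [growthWeight, Pi.add_apply, hnorm, Complex.norm_real, Real.norm_eq_abs, add_div]
  rw [neg_add, Real.rpow_add hpos, Real.rpow_neg_one, div_eq_mul_inv _ (1 + |x|),
    div_eq_mul_inv _ (1 + |x|)]

end growthWeight

/-! ### Stieltjes integrals on the slit domain -/

theorem mem_slitDomain_iff_one_sub_mem_slitPlane {z : ℂ} :
    z ∈ slitDomain ↔ 1 - z ∈ Complex.slitPlane := by
  simp only [slitDomain, mem_compl_iff, mem_image, mem_Ici, Complex.mem_slitPlane_iff]
  refine ⟨fun h => ?_, ?_⟩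
  · by_contra! hz
    simp only [Complex.sub_re, Complex.one_re, sub_nonpos, Complex.sub_im, Complex.one_im, zero_sub,
      neg_eq_zero] at hz
    exact h ⟨z.re, hz.1, Complex.ext rfl hz.2.symm⟩
  · rintro h ⟨x, hx, rfl⟩
    simp [hx.not_gt] at h

theorem isOpen_slitDomain : IsOpen slitDomain := by
  have : slitDomain = (fun z => 1 - z) ⁻¹' Complex.slitPlane :=
    Set.ext fun z => mem_slitDomain_iff_one_sub_mem_slitPlane
  rw [this]
  exact Complex.isOpen_slitPlane.preimage (by fun_prop)

theorem isPreconnected_slitDomain : IsPreconnected slitDomain := by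
  have : slitDomain = (fun z => 1 - z) '' Complex.slitPlane := Set.ext fun z =>
    ⟨fun hz => ⟨1 - z, mem_slitDomain_iff_one_sub_mem_slitPlane.1 hz, sub_sub_cancel 1 z⟩, by
      rintro ⟨w, hw, rfl⟩
      rwa [mem_slitDomain_iff_one_sub_mem_slitPlane, sub_sub_cancel]⟩
  rw [this]
  exact (Complex.starConvex_one_slitPlane.isPathConnected
    (by simp)).isConnected.isPreconnected.image _ (by fun_prop)

theorem ofReal_mem_slitDomain_iff {x : ℝ} : (x : ℂ) ∈ slitDomain ↔ x < 1 := by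
  simp [slitDomain]

theorem one_sub_mul_ne_zero {z : ℂ} (hz : z ∈ slitDomain) {t : ℝ} (ht : t ∈ Icc (0 : ℝ) 1) :
    1 - (t : ℂ) * z ≠ 0 := by
  have := Complex.starConvex_one_slitPlane (mem_slitDomain_iff_one_sub_mem_slitPlane.1 hz)
    (sub_nonneg.2 ht.2) ht.1 (sub_add_cancel 1 t)
  convert Complex.slitPlane_ne_zero this using 1
  simp only [Complex.real_smul, Complex.ofReal_sub, Complex.ofReal_one]
  ring

theorem exists_le_norm_one_sub_mul {z₀ : ℂ} (hz₀ : z₀ ∈ slitDomain) :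
    ∃ c > 0, ∀ z ∈ Metric.ball z₀ c, ∀ t ∈ Icc (0 : ℝ) 1, c ≤ ‖1 - (t : ℂ) * z‖ := by
  have hc : ContinuousOn (fun t : ℝ => ‖1 - (t : ℂ) * z₀‖) (Icc 0 1) := by fun_prop
  obtain ⟨t₀, ht₀, hmin⟩ := isCompact_Icc.exists_isMinOn (nonempty_Icc.2 zero_le_one) hc
  have hpos : 0 < ‖1 - (t₀ : ℂ) * z₀‖ := norm_pos_iff.2 (one_sub_mul_ne_zero hz₀ ht₀)
  refine ⟨‖1 - (t₀ : ℂ) * z₀‖ / 2, by positivity, fun z hz t ht => ?_⟩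
  have hle : ‖1 - (t₀ : ℂ) * z₀‖ ≤ ‖1 - (t : ℂ) * z₀‖ := hmin ht
  have hdiff : ‖1 - (t : ℂ) * z₀‖ - ‖1 - (t : ℂ) * z‖ ≤ ‖z - z₀‖ :=
    calc ‖1 - (t : ℂ) * z₀‖ - ‖1 - (t : ℂ) * z‖ ≤ ‖(t : ℂ) * (z - z₀)‖ := by
          refine (norm_sub_norm_le _ _).trans_eq (congrArg norm ?_)
          ring
      _ ≤ ‖z - z₀‖ := by
          rw [norm_mul, Complex.norm_of_nonneg ht.1]
          exact mul_le_of_le_one_left (norm_nonneg _) ht.2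
  rw [mem_ball_iff_norm] at hz
  linarith

section stieltjes

variable {μ : Measure ℝ} {f : ℝ → ℂ} {z : ℂ}

theorem integrable_div_one_sub_mul (hμ : ∀ᵐ t ∂μ, t ∈ Icc (0 : ℝ) 1) (hf : Integrable f μ)
    (hz : z ∈ slitDomain) : Integrable (fun t : ℝ => f t / (1 - t * z)) μ := by
  obtain ⟨c, hc, hcz⟩ := exists_le_norm_one_sub_mul hz
  simp_rw [div_eq_mul_inv]
  refine hf.mul_bdd (c := c⁻¹) (Measurable.aestronglyMeasurable (by fun_prop)) ?_
  filter_upwards [hμ] with t ht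
  rw [norm_inv]
  exact inv_anti₀ hc (hcz z (Metric.mem_ball_self hc) t ht)

theorem differentiableOn_integral_div_one_sub_mul (hμ : ∀ᵐ t ∂μ, t ∈ Icc (0 : ℝ) 1)
    (hf : Integrable f μ) :
    DifferentiableOn ℂ (fun z : ℂ => ∫ t : ℝ, f t / (1 - t * z) ∂μ) slitDomain := by
  intro z₀ hz₀
  obtain ⟨c, hc, hcz⟩ := exists_le_norm_one_sub_mul hz₀
  have hderiv := hasDerivAt_integral_of_dominated_loc_of_deriv_le (μ := μ)
    (F := fun (z : ℂ) (t : ℝ) => f t / (1 - t * z))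
    (F' := fun (z : ℂ) (t : ℝ) => f t * (t / (1 - t * z) ^ 2))
    (bound := fun t => ‖f t‖ * (c ^ 2)⁻¹) (Metric.ball_mem_nhds z₀ hc)
    (Eventually.of_forall fun z => by
      simp_rw [div_eq_mul_inv]
      exact hf.aestronglyMeasurable.mul (Measurable.aestronglyMeasurable (by fun_prop)))
    (integrable_div_one_sub_mul hμ hf hz₀)
    (hf.aestronglyMeasurable.mul (Measurable.aestronglyMeasurable (by fun_prop)))
    ?_ (hf.norm.mul_const _) ?_
  · exact hderiv.2.differentiableAt.differentiableWithinAt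
  · filter_upwards [hμ] with t ht z hz
    have hle := hcz z hz t ht
    rw [norm_mul, norm_div, norm_pow, Complex.norm_of_nonneg ht.1, div_eq_mul_inv]
    gcongr
    calc t * (‖1 - (t : ℂ) * z‖ ^ 2)⁻¹ ≤ 1 * (c ^ 2)⁻¹ := by
          gcongr
          exact ht.2
      _ = (c ^ 2)⁻¹ := one_mul _
  · filter_upwards [hμ] with t ht z hz
    have hne : 1 - (t : ℂ) * z ≠ 0 := norm_pos_iff.1 (hc.trans_le (hcz z hz t ht))
    have hlin : HasDerivAt (fun z : ℂ => 1 - (t : ℂ) * z) (-(t : ℂ)) z := by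
      simpa using ((hasDerivAt_id z).const_mul (t : ℂ)).const_sub 1
    have hinv := (hlin.inv hne).const_mul (f t)
    rw [neg_neg] at hinv
    exact hinv

end stieltjes

theorem ne_ofReal_of_mem_upperHalf {w : ℂ} (hw : w ∈ upperHalf) (x : ℝ) : w ≠ x := by
  rintro rfl
  simp [upperHalf] at hw

theorem upperHalf_subset_slitDomain : upperHalf ⊆ slitDomain := by
  rintro _ hw ⟨x, -, rfl⟩
  exact ne_ofReal_of_mem_upperHalf hw x rfl

section quotient

variable {F : ℂ → ℂ} {l : Filter ℂ} {α β s b : ℝ}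

theorem isBigO_sub_one_div_cobounded (hl : l ≤ Bornology.cobounded ℂ) (hs : 0 ≤ s) (hs1 : s ≤ 1)
    (hsα : s ≤ 1 - α) (hinf : F =O[l] fun z => ‖z‖ ^ α) :
    (fun w => (F w - 1) / w) =O[l] growthWeight b s := by
  have hweight := isBigO_norm_rpow_growthWeight_cobounded (b := b) hs
  have hone : (fun w : ℂ => w⁻¹) =O[l] growthWeight b s := by
    refine (((isBigO_norm_rpow_cobounded (neg_le_neg hs1)).trans hweight).mono hl).congr_left
      (fun w => ?_) |>.of_norm_left
    rw [Real.rpow_neg_one, norm_inv]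
  have hF : (fun w => F w * w⁻¹) =O[l] growthWeight b s := by
    have hmul := hinf.norm_left.mul (isBigO_refl (fun w : ℂ => ‖w‖⁻¹) l)
    have hle : α - 1 ≤ -s := by linarith
    refine IsBigO.of_norm_left ((hmul.congr' (Eventually.of_forall fun w => ?_) ?_).trans
      (((isBigO_norm_rpow_cobounded hle).trans hweight).mono hl))
    · rw [norm_mul, norm_inv]
    · filter_upwards [hl (Bornology.eventually_ne_cobounded 0)] with w hw
      rw [Real.rpow_sub_one (norm_ne_zero_iff.2 hw), div_eq_mul_inv]
  simpa only [sub_mul, one_mul, div_eq_mul_inv] using hF.sub hone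

theorem isBigO_sub_one_div_nhds_one (hl : l ≤ 𝓝[≠] 1) (hβb : β ≤ b)
    (hone : F =O[l] fun z => ‖z - 1‖ ^ (-β)) :
    (fun w => (F w - 1) / w) =O[l] growthWeight b s := by
  have hl' : l ≤ 𝓝 1 := hl.trans nhdsWithin_le_nhds
  have hF : F =O[l] growthWeight b s :=
    (hone.trans ((isBigO_norm_sub_rpow_nhdsNE hβb 1).mono hl)).trans <|
      IsBigO.of_bound' <| Eventually.of_forall fun w => by
        rw [Real.norm_of_nonneg (by positivity), Real.norm_of_nonneg (growthWeight_nonneg w)]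
        exact rpow_norm_sub_one_le_growthWeight w
  have hconst : (fun _ => (1 : ℂ)) =O[l] growthWeight b s :=
    (isBigO_const_const 1 one_ne_zero _).trans ((isBigO_one_growthWeight_nhds 1).mono hl')
  have hinv : (fun w : ℂ => w⁻¹) =O[l] fun _ => (1 : ℝ) :=
    ((tendsto_inv₀ one_ne_zero).isBigO_one ℝ).mono hl'
  simpa only [div_eq_mul_inv, mul_one] using (hF.sub hconst).mul hinv

theorem isBigO_sub_div_nhds_zero (hF : DifferentiableAt ℂ F 0) :
    (fun w => (F w - F 0) / w) =O[𝓝 0] fun _ => (1 : ℝ) := by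
  have hmul := hF.isBigO_sub.mul (isBigO_refl (fun w : ℂ => w⁻¹) (𝓝 0))
  simp only [sub_zero, ← div_eq_mul_inv] at hmul
  refine hmul.trans (IsBigO.of_bound' (Eventually.of_forall fun w => ?_))
  simpa using div_self_le_one ‖w‖

theorem isBigO_sub_one_div_growthWeight {G : ℂ → ℂ} (hF : DifferentiableOn ℂ F slitDomain)
    (hF0 : F 0 = 1) (hbdry : ∀ x : ℝ, 1 < x → Tendsto F (𝓝[upperHalf] (x : ℂ)) (𝓝 (G x)))
    (hs : 0 ≤ s) (hs1 : s ≤ 1) (hsα : s ≤ 1 - α) (hβb : β ≤ b)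
    (hinf : F =O[Bornology.cobounded ℂ ⊓ 𝓟 upperHalf] fun z => ‖z‖ ^ α)
    (hone : F =O[𝓝[upperHalf] (1 : ℂ)] fun z => ‖z - 1‖ ^ (-β)) :
    (fun w => (F w - 1) / w) =O[𝓟 upperHalf] growthWeight b s := by
  have hbounded {p y : ℂ} (hp : p ≠ 0) (hlim : Tendsto F (𝓝[upperHalf] p) (𝓝 y)) :
      (fun w => (F w - 1) / w) =O[𝓝[upperHalf] p] growthWeight b s :=
    (((hlim.sub_const 1).div (tendsto_id.mono_left nhdsWithin_le_nhds) hp).isBigO_one ℝ).trans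
      ((isBigO_one_growthWeight_nhds p).mono nhdsWithin_le_nhds)
  refine isBigO_principal_of_forall_nhdsWithin ?_ fun p => ?_
  · rw [← Metric.cobounded_eq_cocompact]
    exact isBigO_sub_one_div_cobounded inf_le_left hs hs1 hsα hinf
  by_cases hp : p ∈ slitDomain
  · have hFp := hF.differentiableAt (isOpen_slitDomain.mem_nhds hp)
    rcases eq_or_ne p 0 with rfl | hp0
    · rw [← hF0]
      exact ((isBigO_sub_div_nhds_zero hFp).trans (isBigO_one_growthWeight_nhds 0)).mono
        nhdsWithin_le_nhds
    · exact hbounded hp0 (hFp.continuousAt.tendsto.mono_left nhdsWithin_le_nhds)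
  · obtain ⟨x, hx, rfl : (x : ℂ) = p⟩ := not_not.1 hp
    rcases (mem_Ici.1 hx).eq_or_lt with rfl | hx1
    · rw [Complex.ofReal_one]
      exact isBigO_sub_one_div_nhds_one
        (nhdsWithin_mono _ fun w hw => by simpa using ne_ofReal_of_mem_upperHalf hw 1) hβb hone
    · exact hbounded (by exact_mod_cast (one_pos.trans hx1).ne') (hbdry x hx1)

end quotient

theorem exists_hasDominatedBoundaryValues {h : ℂ → ℂ} {κ : ℝ → ℂ} {b s : ℝ}
    (hh : DifferentiableOn ℂ h upperHalf) (hb : 0 ≤ b) (hs : 0 ≤ s)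
    (hO : h =O[𝓟 upperHalf] growthWeight b s)
    (hlim : ∀ᵐ x : ℝ, Tendsto h (𝓝[upperHalf] (x : ℂ)) (𝓝 (κ x))) :
    ∃ C, HasDominatedBoundaryValues h κ fun x => C * growthWeight b s x := by
  obtain ⟨C, hC, hO⟩ := hO.exists_nonneg
  rw [isBigOWith_principal] at hO
  refine ⟨C, hh, ?_, ?_⟩
  · filter_upwards [self_mem_nhdsWithin] with y hy
    filter_upwards [Measure.ae_ne volume 1] with x hx
    have hre : ((x : ℂ) + y * Complex.I).re = x := by simp
    calc ‖h (x + y * Complex.I)‖ ≤ C * ‖growthWeight b s (x + y * Complex.I)‖ :=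
          hO _ (by simpa [upperHalf] using hy)
      _ ≤ C * growthWeight b s x := by
          rw [Real.norm_of_nonneg (growthWeight_nonneg _)]
          gcongr
          have hle := growthWeight_le_growthWeight_re hb hs (w := x + y * Complex.I) (by rwa [hre])
          rwa [hre] at hle
  · filter_upwards [hlim] with x hx
    refine hx.comp (tendsto_nhdsWithin_iff.2 ⟨tendsto_ofReal_add_mul_I x, ?_⟩)
    filter_upwards [self_mem_nhdsWithin] with y hy
    simpa [upperHalf] using hy

theorem exists_boundary_sub_one_div {F G : ℂ → ℂ} (hF : DifferentiableOn ℂ F slitDomain)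
    (hbdry : ∀ x : ℝ, 1 < x → Tendsto F (𝓝[upperHalf] (x : ℂ)) (𝓝 (G x)))
    (hreal : ∀ x : ℝ, x < 1 → (F x).im = 0) :
    ∃ κ : ℝ → ℂ,
      (∀ᵐ x : ℝ, Tendsto (fun w => (F w - 1) / w) (𝓝[upperHalf] (x : ℂ)) (𝓝 (κ x))) ∧
      (fun x => (κ x).im) =ᵐ[volume] (Ioi 1).indicator fun x : ℝ => (G x).im / x := by
  refine ⟨fun x => ((if x < 1 then F x else G x) - 1) / x, ?_, ?_⟩
  · filter_upwards [Measure.ae_ne volume 0, Measure.ae_ne volume 1] with x hx0 hx1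
    refine Tendsto.div (Tendsto.sub_const ?_ 1) (tendsto_id.mono_left nhdsWithin_le_nhds)
      (by exact_mod_cast hx0)
    rcases hx1.lt_or_gt with hx | hx
    · rw [if_pos hx]
      exact (hF.differentiableAt (isOpen_slitDomain.mem_nhds
        (ofReal_mem_slitDomain_iff.2 hx))).continuousAt.tendsto.mono_left nhdsWithin_le_nhds
    · rw [if_neg hx.not_gt]
      exact hbdry x hx
  · filter_upwards [Measure.ae_ne volume 1] with x hx1
    rw [Complex.div_ofReal_im, Complex.sub_im, Complex.one_im, sub_zero]
    rcases hx1.lt_or_gt with hx | hx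
    · rw [indicator_of_notMem (notMem_Ioi.2 hx.le), if_pos hx, hreal x hx, zero_div]
    · rw [indicator_of_mem (mem_Ioi.2 hx), if_neg hx.not_gt]

theorem integral_im_div_eq_sub_one_div {F G : ℂ → ℂ} {α β : ℝ}
    (hF : DifferentiableOn ℂ F slitDomain) (hF0 : F 0 = 1)
    (hbdry : ∀ x : ℝ, 1 < x → Tendsto F (𝓝[upperHalf] (x : ℂ)) (𝓝 (G x)))
    (hreal : ∀ x : ℝ, x < 1 → (F x).im = 0)
    (hα : α < 1) (hinf : F =O[Bornology.cobounded ℂ ⊓ 𝓟 upperHalf] fun z => ‖z‖ ^ α)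
    (hβ : β < 1) (hone : F =O[𝓝[upperHalf] (1 : ℂ)] fun z => ‖z - 1‖ ^ (-β))
    {z : ℂ} (hz : z ∈ upperHalf) :
    IntegrableOn (fun x : ℝ => (((G x).im / x : ℝ) : ℂ) / (x - z)) (Ioi 1) ∧
      ∫ x : ℝ in Ioi 1, (((G x).im / x : ℝ) : ℂ) / (x - z) = Real.pi * ((F z - 1) / z) := by
  set b := max β (1 / 2)
  set s := min (1 - α) 1
  have hb : 0 < b := lt_max_of_lt_right one_half_pos
  have hb1 : b < 1 := max_lt hβ one_half_lt_one
  have hs : 0 < s := lt_min (sub_pos.2 hα) one_pos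
  have hO : (fun w => (F w - 1) / w) =O[𝓟 upperHalf] growthWeight b s :=
    isBigO_sub_one_div_growthWeight hF hF0 hbdry hs.le (min_le_right _ _) (min_le_left _ _)
      (le_max_left _ _) hinf hone
  have hdecay : Tendsto (fun w => (F w - 1) / w) (Bornology.cobounded ℂ ⊓ 𝓟 upperHalf) (𝓝 0) :=
    (hO.mono inf_le_right).trans_tendsto
      ((tendsto_growthWeight_cobounded hb hs).mono_left inf_le_left)
  have hdiff : DifferentiableOn ℂ (fun w => (F w - 1) / w) upperHalf :=
    ((hF.mono upperHalf_subset_slitDomain).sub_const 1).div differentiableOn_id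
      fun w hw => by simpa using ne_ofReal_of_mem_upperHalf hw 0
  obtain ⟨κ, hκ, hκ_im⟩ := exists_boundary_sub_one_div hF hbdry hreal
  obtain ⟨C, H⟩ := exists_hasDominatedBoundaryValues hdiff hb.le hs.le hO hκ
  obtain ⟨hint, heq⟩ := H.schwarz (by
    simpa only [mul_div_assoc] using (integrable_growthWeight_div hb hb1 hs).const_mul C) hdecay hz
  have hκ_kernel : (fun x : ℝ => ((κ x).im : ℂ) / (x - z)) =ᵐ[volume]
      (Ioi 1).indicator fun x : ℝ => (((G x).im / x : ℝ) : ℂ) / (x - z) := by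
    filter_upwards [hκ_im] with x hx
    rw [hx]
    by_cases hx1 : x ∈ Ioi 1 <;> simp [hx1]
  rw [← integrable_indicator_iff measurableSet_Ioi, ← integral_indicator measurableSet_Ioi]
  exact ⟨hint.congr hκ_kernel, (integral_congr_ae hκ_kernel).symm.trans heq⟩

/-! ### The spectral measure -/

/-- The absolutely continuous part `(Im G(1/t) / (π t)) dt` of `slitMeasure α₀ α₁ G`. -/
noncomputable def slitDensityMeasure (G : ℂ → ℂ) : Measure ℝ :=
  (volume.restrict (Ioo (0 : ℝ) 1)).withDensity
    (fun t : ℝ => ENNReal.ofReal ((G ((1 / t : ℝ) : ℂ)).im / (Real.pi * t)))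

theorem integral_Ioi_one_eq_integral_Ioo {E : Type*} [NormedAddCommGroup E] [NormedSpace ℝ E]
    (g : ℝ → E) :
    (IntegrableOn g (Ioi 1) ↔ IntegrableOn (fun t : ℝ => (t ^ 2)⁻¹ • g t⁻¹) (Ioo 0 1)) ∧
      ∫ x in Ioi (1 : ℝ), g x = ∫ t in Ioo (0 : ℝ) 1, (t ^ 2)⁻¹ • g t⁻¹ := by
  have himage : (fun t : ℝ => t⁻¹) '' Ioo 0 1 = Ioi 1 := by
    rw [image_inv_eq_inv, inv_Ioo_0_left one_pos, inv_one]
  have hderiv : ∀ t ∈ Ioo (0 : ℝ) 1,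
      HasDerivWithinAt (fun t : ℝ => t⁻¹) (-(t ^ 2)⁻¹) (Ioo 0 1) t :=
    fun t ht => (hasDerivAt_inv ht.1.ne').hasDerivWithinAt
  have habs : ∀ t : ℝ, |-(t ^ 2)⁻¹| = (t ^ 2)⁻¹ := fun t => by
    rw [abs_neg, abs_of_nonneg (by positivity)]
  rw [← himage,
    integrableOn_image_iff_integrableOn_abs_deriv_smul measurableSet_Ioo hderiv inv_injective.injOn,
    integral_image_eq_integral_abs_deriv_smul measurableSet_Ioo hderiv inv_injective.injOn]
  simp only [habs, and_self]

theorem integral_slitDensityMeasure {E : Type*} [NormedAddCommGroup E] [NormedSpace ℝ E]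
    {G : ℂ → ℂ} (hG : ContinuousOn (fun x : ℝ => G x) (Ioi 1))
    (hG0 : ∀ x : ℝ, 1 < x → 0 ≤ (G x).im) (φ : ℝ → E) :
    (Integrable φ (slitDensityMeasure G) ↔
      IntegrableOn (fun x : ℝ => ((G x).im / (Real.pi * x)) • φ x⁻¹) (Ioi 1)) ∧
    ∫ t, φ t ∂slitDensityMeasure G =
      ∫ x : ℝ in Ioi 1, ((G x).im / (Real.pi * x)) • φ x⁻¹ := by
  set d : ℝ → ℝ := fun t => (G ((1 / t : ℝ) : ℂ)).im / (Real.pi * t) with hd_def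
  have hinv : MapsTo (fun t : ℝ => 1 / t) (Ioo 0 1) (Ioi 1) := fun t ht => by
    simpa using (one_lt_inv₀ ht.1).2 ht.2
  have hd : ContinuousOn d (Ioo 0 1) := by
    have hcomp : ContinuousOn (fun t : ℝ => G ((1 / t : ℝ) : ℂ)) (Ioo 0 1) :=
      hG.comp (continuousOn_const.div continuousOn_id fun t ht => ht.1.ne') hinv
    exact (Complex.continuous_im.comp_continuousOn hcomp).div (by fun_prop)
      fun t ht => (mul_pos Real.pi_pos ht.1).ne'
  have hd_meas := (hd.aemeasurable measurableSet_Ioo (μ := volume)).ennreal_ofReal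
  have hd_fin : ∀ᵐ t ∂volume.restrict (Ioo (0 : ℝ) 1), ENNReal.ofReal (d t) < ⊤ :=
    Eventually.of_forall fun t => ENNReal.ofReal_lt_top
  have hintegrand : EqOn (fun t => (ENNReal.ofReal (d t)).toReal • φ t)
      (fun t => (t ^ 2)⁻¹ • ((G ((t⁻¹ : ℝ) : ℂ)).im / (Real.pi * t⁻¹)) • φ t⁻¹⁻¹)
      (Ioo 0 1) := fun t ht => by
    have ht0 : t ≠ 0 := ht.1.ne'
    have hdt : (ENNReal.ofReal (d t)).toReal = d t :=
      ENNReal.toReal_ofReal (div_nonneg (hG0 _ (hinv ht)) (mul_pos Real.pi_pos ht.1).le)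
    beta_reduce
    rw [hdt]
    simp only [inv_inv, smul_smul, hd_def, one_div]
    congr 1
    field_simp
  rw [slitDensityMeasure, integrable_withDensity_iff_integrable_smul₀' hd_meas hd_fin,
    integral_withDensity_eq_integral_toReal_smul₀ hd_meas hd_fin,
    (integral_Ioi_one_eq_integral_Ioo _).1, (integral_Ioi_one_eq_integral_Ioo _).2]
  exact ⟨integrableOn_congr_fun hintegrand measurableSet_Ioo,
    setIntegral_congr_fun measurableSet_Ioo hintegrand⟩

theorem ae_slitDensityMeasure_mem_Ioo (G : ℂ → ℂ) :
    ∀ᵐ t ∂slitDensityMeasure G, t ∈ Ioo (0 : ℝ) 1 :=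
  (withDensity_absolutelyContinuous _ _).ae_le (ae_restrict_mem measurableSet_Ioo)

theorem slitDensityMeasure_singleton (G : ℂ → ℂ) (t : ℝ) : slitDensityMeasure G {t} = 0 :=
  withDensity_absolutelyContinuous _ _ (measure_singleton t)

theorem slitMeasure_real_singleton_zero {α₀ : ℝ} (hα₀ : 0 ≤ α₀) (α₁ : ℝ) (G : ℂ → ℂ) :
    (slitMeasure α₀ α₁ G).real {0} = α₀ := by
  rw [slitMeasure, ← slitDensityMeasure, measureReal_def, Measure.add_apply,
    slitDensityMeasure_singleton]
  simp [hα₀]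

theorem slitMeasure_real_singleton_one (α₀ : ℝ) {α₁ : ℝ} (hα₁ : 0 ≤ α₁) (G : ℂ → ℂ) :
    (slitMeasure α₀ α₁ G).real {1} = α₁ := by
  rw [slitMeasure, ← slitDensityMeasure, measureReal_def, Measure.add_apply,
    slitDensityMeasure_singleton]
  simp [hα₁]

theorem slitMeasure_zero_right (α₀ : ℝ) (G : ℂ → ℂ) :
    slitMeasure α₀ 0 G = ENNReal.ofReal α₀ • Measure.dirac (0 : ℝ) + slitDensityMeasure G := by
  rw [slitMeasure, ENNReal.ofReal_zero, zero_smul, add_zero, slitDensityMeasure]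

theorem continuousOn_Ioi_of_tendsto_upperHalf {F G : ℂ → ℂ} {a : ℝ}
    (hbdry : ∀ x : ℝ, a < x → Tendsto F (𝓝[upperHalf] (x : ℂ)) (𝓝 (G x))) :
    ContinuousOn (fun x : ℝ => G x) (Ioi a) := by
  have hclosure : ∀ x : ℝ, (x : ℂ) ∈ closure upperHalf := fun x => by
    simp [upperHalf]
  have hext : ContinuousOn (extendFrom upperHalf F) (Complex.ofReal '' Ioi a) :=
    continuousOn_extendFrom (by rintro _ ⟨x, -, rfl⟩; exact hclosure x)
      (by rintro _ ⟨x, hx, rfl⟩; exact ⟨_, hbdry x hx⟩)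
  exact (hext.comp Complex.continuous_ofReal.continuousOn (mapsTo_image _ _)).congr
    fun x hx => (extendFrom_eq (hclosure x) (hbdry x hx)).symm

theorem integral_slitDensityMeasure_div_one_sub_mul {G : ℂ → ℂ}
    (hG : ContinuousOn (fun x : ℝ => G x) (Ioi 1)) (hG0 : ∀ x : ℝ, 1 < x → 0 ≤ (G x).im) (z : ℂ) :
    (Integrable (fun t : ℝ => (t : ℂ) / (1 - t * z)) (slitDensityMeasure G) ↔
      IntegrableOn (fun x : ℝ => (((G x).im / x : ℝ) : ℂ) / (x - z)) (Ioi 1)) ∧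
    ∫ t : ℝ, (t : ℂ) / (1 - t * z) ∂slitDensityMeasure G =
      (Real.pi : ℂ)⁻¹ * ∫ x : ℝ in Ioi 1, (((G x).im / x : ℝ) : ℂ) / (x - z) := by
  have hkernel : EqOn (fun x : ℝ => ((G x).im / (Real.pi * x)) •
        (((x⁻¹ : ℝ) : ℂ) / (1 - ((x⁻¹ : ℝ) : ℂ) * z)))
      (fun x : ℝ => (Real.pi : ℂ)⁻¹ * ((((G x).im / x : ℝ) : ℂ) / (x - z))) (Ioi 1) := by
    intro x hx
    have hx0 : (x : ℂ) ≠ 0 := by exact_mod_cast (one_pos.trans hx).ne'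
    have hinv : ((x⁻¹ : ℝ) : ℂ) / (1 - ((x⁻¹ : ℝ) : ℂ) * z) = 1 / (x - z) := by
      rw [Complex.ofReal_inv, inv_mul_eq_div, one_sub_div hx0, inv_div_left, div_mul_cancel₀ _ hx0,
        one_div]
    simp only [hinv, Complex.real_smul]
    push_cast
    ring
  have hpi : IsUnit (Real.pi : ℂ)⁻¹ := by simp [Real.pi_ne_zero]
  obtain ⟨hiff, hval⟩ := integral_slitDensityMeasure hG hG0 fun t : ℝ => (t : ℂ) / (1 - t * z)
  rw [hiff, hval, setIntegral_congr_fun measurableSet_Ioi hkernel, integral_const_mul,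
    integrableOn_congr_fun hkernel measurableSet_Ioi]
  exact ⟨integrable_const_mul_iff hpi _, rfl⟩

theorem eq_one_add_mul_integral_of_upperHalf {F : ℂ → ℂ} {μ : Measure ℝ} {f : ℝ → ℂ}
    (hμ : ∀ᵐ t ∂μ, t ∈ Icc (0 : ℝ) 1) (hf : Integrable f μ) (hF : DifferentiableOn ℂ F slitDomain)
    (hrep : ∀ z ∈ upperHalf, ∫ t : ℝ, f t / (1 - t * z) ∂μ = (F z - 1) / z) :
    ∀ z ∈ slitDomain, F z = 1 + z * ∫ t : ℝ, f t / (1 - t * z) ∂μ := by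
  have hI : Complex.I ∈ upperHalf := by simp [upperHalf]
  refine (hF.analyticOnNhd isOpen_slitDomain).eqOn_of_preconnected_of_eventuallyEq
    (((differentiableOn_id.mul (differentiableOn_integral_div_one_sub_mul hμ hf)).const_add
      1).analyticOnNhd isOpen_slitDomain) isPreconnected_slitDomain
    (upperHalf_subset_slitDomain hI) ?_
  filter_upwards [isOpen_upperHalf.mem_nhds hI] with w hw
  have hw0 : w ≠ 0 := by simpa using ne_ofReal_of_mem_upperHalf hw 0
  rw [hrep w hw, mul_div_cancel₀ _ hw0, add_sub_cancel]

theorem integrable_of_integrable_div_one_sub_mul {μ : Measure ℝ} {f : ℝ → ℂ} {z : ℂ}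
    (hμ : ∀ᵐ t ∂μ, t ∈ Icc (0 : ℝ) 1) (hz : z ∈ slitDomain)
    (h : Integrable (fun t : ℝ => f t / (1 - t * z)) μ) : Integrable f μ := by
  refine (h.mul_bdd (c := 1 + ‖z‖) (g := fun t : ℝ => 1 - (t : ℂ) * z)
    (Measurable.aestronglyMeasurable (by fun_prop)) ?_).congr ?_
  · filter_upwards [hμ] with t ht
    refine (norm_sub_le _ _).trans (add_le_add norm_one.le ?_)
    rw [norm_mul, Complex.norm_of_nonneg ht.1]
    exact mul_le_of_le_one_left (norm_nonneg z) ht.2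
  · filter_upwards [hμ] with t ht
    exact div_mul_cancel₀ _ (one_sub_mul_ne_zero hz ht)

section positivity

variable {μ : Measure ℝ} {x : ℝ}

theorem one_sub_mul_pos (hx : x < 1) {t : ℝ} (ht : t ∈ Icc (0 : ℝ) 1) : 0 < 1 - t * x := by
  rcases ht.1.eq_or_lt with rfl | ht0
  · simp
  · nlinarith [ht.2]

theorem integrable_real_div_one_sub_mul (hμ : ∀ᵐ t ∂μ, t ∈ Icc (0 : ℝ) 1)
    (hid : Integrable (fun t : ℝ => (t : ℂ)) μ) (hx : x < 1) :
    Integrable (fun t : ℝ => t / (1 - t * x)) μ := by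
  refine (integrable_div_one_sub_mul hμ hid (ofReal_mem_slitDomain_iff.2 hx)).re.congr
    (Eventually.of_forall fun t => ?_)
  exact_mod_cast Complex.ofReal_re (t / (1 - t * x))

theorem monotoneOn_one_add_mul_integral (hμ : ∀ᵐ t ∂μ, t ∈ Icc (0 : ℝ) 1)
    (hid : Integrable (fun t : ℝ => (t : ℂ)) μ) :
    MonotoneOn (fun x : ℝ => 1 + x * ∫ t, t / (1 - t * x) ∂μ) (Iio 1) := by
  intro x hx y hy hxy
  simp only [← integral_const_mul]
  refine add_le_add_right (integral_mono_ae
    ((integrable_real_div_one_sub_mul hμ hid hx).const_mul x)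
    ((integrable_real_div_one_sub_mul hμ hid hy).const_mul y) ?_) 1
  filter_upwards [hμ] with t ht
  rw [mul_div_assoc', mul_div_assoc', div_le_div_iff₀ (one_sub_mul_pos hx ht)
    (one_sub_mul_pos hy ht)]
  linarith [mul_le_mul_of_nonneg_right hxy ht.1]

theorem nonneg_of_limsup_nonneg {f : ℝ → ℝ} {a : ℝ} (hmono : MonotoneOn f (Iio a))
    (hlim : (0 : EReal) ≤ limsup (fun x : ℝ => (f x : EReal)) atBot) (hx : x < a) :
    0 ≤ f x := by
  have hle : limsup (fun x : ℝ => (f x : EReal)) atBot ≤ (f x : EReal) := by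
    refine limsup_le_of_le (by isBoundedDefault) ?_
    filter_upwards [eventually_le_atBot x] with y hy
    exact EReal.coe_le_coe_iff.2 (hmono (hy.trans_lt hx) hx hy)
  exact_mod_cast hlim.trans hle

theorem tendsto_mul_div_one_add_mul {t : ℝ} (ht : t ≠ 0) :
    Tendsto (fun y : ℝ => y * (t / (1 + t * y))) atTop (𝓝 1) := by
  have hlim : Tendsto (fun y : ℝ => t / (y⁻¹ + t)) atTop (𝓝 (t / (0 + t))) :=
    tendsto_const_nhds.div (tendsto_inv_atTop_zero.add_const t) (by simpa using ht)
  rw [zero_add, div_self ht] at hlim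
  refine hlim.congr' ?_
  filter_upwards [eventually_gt_atTop 0] with y hy
  rw [mul_div_assoc', ← mul_div_mul_left t (y⁻¹ + t) hy.ne', mul_add, mul_inv_cancel₀ hy.ne',
    mul_comm t y]

theorem measure_univ_le_one_of_nonneg (hμ : ∀ᵐ t ∂μ, t ∈ Ioc (0 : ℝ) 1)
    (hid : Integrable (fun t : ℝ => (t : ℂ)) μ)
    (hnonneg : ∀ x < 1, 0 ≤ 1 + x * ∫ t, t / (1 - t * x) ∂μ) : μ univ ≤ 1 := by
  have hμ' : ∀ᵐ t ∂μ, t ∈ Icc (0 : ℝ) 1 := hμ.mono fun t ht => Ioc_subset_Icc_self ht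
  have hbound : ∀ n : ℕ, ∫⁻ t, ENNReal.ofReal (n * (t / (1 + t * n))) ∂μ ≤ 1 := fun n => by
    have hn : -(n : ℝ) < 1 := by linarith [n.cast_nonneg (α := ℝ)]
    have hint : Integrable (fun t : ℝ => n * (t / (1 + t * n))) μ := by
      simpa using (integrable_real_div_one_sub_mul hμ' hid hn).const_mul n
    rw [← ofReal_integral_eq_lintegral_ofReal hint, ENNReal.ofReal_le_one, integral_const_mul]
    · simpa [← sub_eq_add_neg] using hnonneg _ hn
    · filter_upwards [hμ] with t ht
      have := ht.1
      positivity
  have hlim : ∀ᵐ t ∂μ, 1 = liminf (fun n : ℕ => ENNReal.ofReal (n * (t / (1 + t * n)))) atTop := by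
    filter_upwards [hμ] with t ht
    simpa using (ENNReal.tendsto_ofReal ((tendsto_mul_div_one_add_mul ht.1.ne').comp
      tendsto_natCast_atTop_atTop)).liminf_eq.symm
  calc μ univ = ∫⁻ t, liminf (fun n : ℕ => ENNReal.ofReal (n * (t / (1 + t * n)))) atTop ∂μ := by
        rw [← lintegral_congr_ae hlim, lintegral_one]
    _ ≤ liminf (fun n : ℕ => ∫⁻ t, ENNReal.ofReal (n * (t / (1 + t * n))) ∂μ) atTop :=
        lintegral_liminf_le fun n => by fun_prop
    _ ≤ 1 := liminf_le_of_le (by isBoundedDefault)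
        fun b hb => (hb.exists.choose_spec).trans (hbound _)

end positivity

theorem eq_ofReal_one_add_mul_integral {F : ℂ → ℂ} {μ : Measure ℝ} {x : ℝ}
    (hF : F x = 1 + x * ∫ t : ℝ, (t : ℂ) / (1 - t * x) ∂μ) :
    F x = ((1 + x * ∫ t, t / (1 - t * x) ∂μ : ℝ) : ℂ) := by
  rw [hF]
  push_cast
  rw [← integral_complex_ofReal]
  push_cast
  rfl

theorem measure_univ_le_one_of_limsup_nonneg {F : ℂ → ℂ} {μ : Measure ℝ}
    (hμ : ∀ᵐ t ∂μ, t ∈ Ioc (0 : ℝ) 1) (hid : Integrable (fun t : ℝ => (t : ℂ)) μ)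
    (hF : ∀ x : ℝ, x < 1 → F x = 1 + x * ∫ t : ℝ, (t : ℂ) / (1 - t * x) ∂μ)
    (hlim : (0 : EReal) ≤ limsup (fun x : ℝ => ((F x).re : EReal)) atBot) : μ univ ≤ 1 := by
  have hre (x : ℝ) (hx : x < 1) : (F x).re = 1 + x * ∫ t, t / (1 - t * x) ∂μ := by
    rw [eq_ofReal_one_add_mul_integral (hF x hx), Complex.ofReal_re]
  have hmono : MonotoneOn (fun x : ℝ => (F x).re) (Iio 1) :=
    (monotoneOn_one_add_mul_integral (hμ.mono fun t ht => Ioc_subset_Icc_self ht) hid).congr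
      fun x hx => (hre x hx).symm
  exact measure_univ_le_one_of_nonneg hμ hid fun x hx =>
    hre x hx ▸ nonneg_of_limsup_nonneg hmono hlim hx

/-! ### Representing measures -/

theorem isRepresentingMeasure_of_eq_one_add_mul_integral {F : ℂ → ℂ} {μ : Measure ℝ}
    (hμ : ∀ᵐ t ∂μ, t ∈ Icc (0 : ℝ) 1) (hμ1 : μ univ ≤ 1)
    (hF : ∀ z ∈ slitDomain, F z = 1 + z * ∫ t : ℝ, (t : ℂ) / (1 - t * z) ∂μ) :
    IsRepresentingMeasure (ENNReal.ofReal (1 - μ.real univ) • Measure.dirac 0 + μ) F := by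
  have hfin : IsFiniteMeasure μ := ⟨hμ1.trans_lt ENNReal.one_lt_top⟩
  have hreal : μ.real univ ≤ 1 := ENNReal.toReal_le_of_le_ofReal one_pos.le (by simpa using hμ1)
  have hν : ∀ᵐ t ∂(ENNReal.ofReal (1 - μ.real univ) • Measure.dirac 0 + μ), t ∈ Icc (0 : ℝ) 1 := by
    refine ae_add_measure_iff.2 ⟨Measure.ae_smul_measure ?_ _, hμ⟩
    exact (ae_dirac_iff (p := (· ∈ Icc (0 : ℝ) 1)) measurableSet_Icc).2 ⟨le_rfl, zero_le_one⟩
  refine ⟨⟨?_⟩, hν, fun z hz => ?_⟩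
  · rw [Measure.add_apply, Measure.smul_apply, measure_univ, smul_eq_mul, mul_one,
      ← ofReal_measureReal, ← ENNReal.ofReal_add (sub_nonneg.2 hreal) measureReal_nonneg,
      sub_add_cancel, ENNReal.ofReal_one]
  · have hint : Integrable (fun t : ℝ => 1 / (1 - (t : ℂ) * z)) μ :=
      integrable_div_one_sub_mul hμ (integrable_const 1) hz
    have hsplit : ∀ᵐ t : ℝ ∂μ, z * ((t : ℂ) / (1 - t * z)) = 1 / (1 - (t : ℂ) * z) - 1 := by
      filter_upwards [hμ] with t ht
      rw [div_sub_one (one_sub_mul_ne_zero hz ht), sub_sub_cancel, mul_div_assoc', mul_comm]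
    rw [hF z hz, ← integral_const_mul, integral_congr_ae hsplit,
      integral_sub hint (integrable_const 1), Measure.restrict_eq_self_of_ae_mem hν,
      integral_add_measure _ hint, integral_smul_measure, integral_dirac,
      ENNReal.toReal_ofReal (sub_nonneg.2 hreal), integral_const]
    · simp only [Complex.real_smul, Complex.ofReal_sub, Complex.ofReal_one, Complex.ofReal_zero,
        zero_mul, sub_zero, div_one, mul_one]
      ring
    · exact (integrable_dirac enorm_lt_top).smul_measure ENNReal.ofReal_ne_top

namespace IsRepresentingMeasure

variable {μ : Measure ℝ} {F : ℂ → ℂ}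

theorem ae_mem_Icc (h : IsRepresentingMeasure μ F) : ∀ᵐ t ∂μ, t ∈ Icc (0 : ℝ) 1 :=
  h.compl_Icc_eq_zero

theorem apply_ofReal (h : IsRepresentingMeasure μ F) {x : ℝ} (hx : x < 1) :
    F x = ((∫ t, 1 / (1 - t * x) ∂μ : ℝ) : ℂ) := by
  rw [h.eq_integral x (ofReal_mem_slitDomain_iff.2 hx),
    Measure.restrict_eq_self_of_ae_mem h.ae_mem_Icc, ← integral_complex_ofReal]
  push_cast
  rfl

theorem tendsto_atBot (h : IsRepresentingMeasure μ F) :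
    Tendsto (fun x : ℝ => F x) atBot (𝓝 (μ.real {0} : ℂ)) := by
  have := h.isProbabilityMeasure
  have hlim : Tendsto (fun x : ℝ => ∫ t, 1 / (1 - t * x) ∂μ) atBot (𝓝 (μ.real {0})) := by
    rw [← integral_indicator_one (measurableSet_singleton 0)]
    refine tendsto_integral_filter_of_dominated_convergence (fun _ => 1)
      (Eventually.of_forall fun x => Measurable.aestronglyMeasurable (by fun_prop)) ?_
      (integrable_const 1) ?_
    · filter_upwards [eventually_le_atBot 0] with x hx
      filter_upwards [h.ae_mem_Icc] with t ht
      have hle : 1 ≤ 1 - t * x := by linarith [mul_nonpos_of_nonneg_of_nonpos ht.1 hx]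
      rw [Real.norm_of_nonneg (by positivity)]
      exact div_le_one_of_le₀ hle (by positivity)
    · filter_upwards [h.ae_mem_Icc] with t ht
      rcases ht.1.eq_or_lt with rfl | ht0
      · simp
      · rw [indicator_of_notMem (by simpa using ht0.ne')]
        refine tendsto_const_nhds.div_atTop ?_
        simpa [sub_eq_add_neg] using tendsto_atTop_add_const_left atBot 1
          (tendsto_neg_atBot_atTop.comp (tendsto_id.const_mul_atBot ht0))
  refine ((Complex.continuous_ofReal.tendsto _).comp hlim).congr' ?_
  filter_upwards [eventually_lt_atBot 1] with x hx using (h.apply_ofReal hx).symm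

theorem tendsto_one_sub_mul (h : IsRepresentingMeasure μ F) :
    Tendsto (fun x : ℝ => (1 - (x : ℂ)) * F x) (𝓝[<] 1) (𝓝 (μ.real {1} : ℂ)) := by
  have := h.isProbabilityMeasure
  have hlim : Tendsto (fun x : ℝ => ∫ t, (1 - x) * (1 / (1 - t * x)) ∂μ) (𝓝[<] 1)
      (𝓝 (μ.real {1})) := by
    rw [← integral_indicator_one (measurableSet_singleton 1)]
    refine tendsto_integral_filter_of_dominated_convergence (fun _ => 1)
      (Eventually.of_forall fun x => Measurable.aestronglyMeasurable (by fun_prop)) ?_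
      (integrable_const 1) ?_
    · filter_upwards [Ioo_mem_nhdsLT one_pos] with x hx
      filter_upwards [h.ae_mem_Icc] with t ht
      have hle : 1 - x ≤ 1 - t * x := by linarith [mul_le_of_le_one_left hx.1.le ht.2]
      have hx1 : 0 < 1 - x := sub_pos.2 hx.2
      have hpos : 0 < 1 - t * x := hx1.trans_le hle
      rw [mul_one_div, Real.norm_of_nonneg (by positivity)]
      exact div_le_one_of_le₀ hle hpos.le
    · filter_upwards [h.ae_mem_Icc] with t ht
      rcases ht.2.eq_or_lt with rfl | ht1
      · refine tendsto_const_nhds.congr' ?_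
        filter_upwards [self_mem_nhdsWithin] with x hx
        simp [(sub_pos.2 (mem_Iio.1 hx)).ne']
      · rw [indicator_of_notMem (by simpa using ht1.ne)]
        have hcont : ContinuousAt (fun x : ℝ => (1 - x) * (1 / (1 - t * x))) 1 :=
          ContinuousAt.mul (by fun_prop)
            (ContinuousAt.div (by fun_prop) (by fun_prop) (by simpa using (sub_pos.2 ht1).ne'))
        simpa [ContinuousAt] using hcont.tendsto.mono_left nhdsWithin_le_nhds
  refine ((Complex.continuous_ofReal.tendsto _).comp hlim).congr' ?_
  filter_upwards [self_mem_nhdsWithin] with x hx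
  rw [h.apply_ofReal hx, Function.comp_apply, integral_const_mul]
  push_cast
  rfl

end IsRepresentingMeasure

theorem integrable_and_eq_one_add_mul_integral_slitDensityMeasure {F G : ℂ → ℂ} {α β : ℝ}
    (hF : DifferentiableOn ℂ F slitDomain) (hF0 : F 0 = 1)
    (hbdry : ∀ x : ℝ, 1 < x → Tendsto F (𝓝[upperHalf] (x : ℂ)) (𝓝 (G x)))
    (hreal : ∀ x : ℝ, x < 1 → (F x).im = 0) (hG0 : ∀ x : ℝ, 1 < x → 0 ≤ (G x).im)
    (hα : α < 1) (hinf : F =O[Bornology.cobounded ℂ ⊓ 𝓟 upperHalf] fun z => ‖z‖ ^ α)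
    (hβ : β < 1) (hone : F =O[𝓝[upperHalf] (1 : ℂ)] fun z => ‖z - 1‖ ^ (-β)) :
    Integrable (fun t : ℝ => (t : ℂ)) (slitDensityMeasure G) ∧
      ∀ z ∈ slitDomain, F z = 1 + z * ∫ t : ℝ, (t : ℂ) / (1 - t * z) ∂slitDensityMeasure G := by
  have hmem : ∀ᵐ t ∂slitDensityMeasure G, t ∈ Icc (0 : ℝ) 1 :=
    (ae_slitDensityMeasure_mem_Ioo G).mono fun t ht => Ioo_subset_Icc_self ht
  have hG := continuousOn_Ioi_of_tendsto_upperHalf hbdry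
  have hupper {z : ℂ} (hz : z ∈ upperHalf) :
      Integrable (fun t : ℝ => (t : ℂ) / (1 - t * z)) (slitDensityMeasure G) ∧
        ∫ t : ℝ, (t : ℂ) / (1 - t * z) ∂slitDensityMeasure G = (F z - 1) / z := by
    obtain ⟨hint, heq⟩ := integral_im_div_eq_sub_one_div hF hF0 hbdry hreal hα hinf hβ hone hz
    obtain ⟨hiff, hval⟩ := integral_slitDensityMeasure_div_one_sub_mul hG hG0 z
    refine ⟨hiff.2 hint, ?_⟩
    rw [hval, heq, inv_mul_cancel_left₀ (by exact_mod_cast Real.pi_ne_zero)]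
  have hI : Complex.I ∈ upperHalf := by simp [upperHalf]
  have hid : Integrable (fun t : ℝ => (t : ℂ)) (slitDensityMeasure G) :=
    integrable_of_integrable_div_one_sub_mul hmem (upperHalf_subset_slitDomain hI) (hupper hI).1
  exact ⟨hid, eq_one_add_mul_integral_of_upperHalf hmem hid hF fun z hz => (hupper hz).2⟩

theorem theorem2p5_general {F Fplus : ℂ → ℂ}
    (hF : DifferentiableOn ℂ F slitDomain)
    (hF0 : F 0 = 1)
    (hbdry : ∀ x : ℝ, 1 < x → Tendsto F (𝓝[upperHalf] (x : ℂ)) (𝓝 (Fplus x)))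
    (h1 : ∀ x : ℝ, x < 1 → (F x).im = 0)
    (h2 : (0 : EReal) ≤ limsup (fun x : ℝ => ((F x).re : EReal)) atBot)
    (h3 : ∀ x : ℝ, 1 < x → 0 ≤ (Fplus x).im)
    (h4 : ∃ α : ℝ, α < 1 ∧
      F =O[Bornology.cobounded ℂ ⊓ 𝓟 upperHalf] (fun z : ℂ => ‖z‖ ^ α))
    (h5 : ∃ α : ℝ, α < 1 ∧
      F =O[𝓝[upperHalf] (1 : ℂ)] (fun z : ℂ => ‖z - 1‖ ^ (-α))) :
    F ∈ classT ∧
    ∃ α₀ : ℝ, 0 ≤ α₀ ∧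
      Tendsto (fun x : ℝ => F x) atBot (𝓝 (α₀ : ℂ)) ∧
      Tendsto (fun x : ℝ => (1 - (x : ℂ)) * F x) (𝓝[<] (1 : ℝ)) (𝓝 0) ∧
      IsRepresentingMeasure (slitMeasure α₀ 0 Fplus) F := by
  obtain ⟨α, hα, h4⟩ := h4
  obtain ⟨β, hβ, h5⟩ := h5
  obtain ⟨hid, hrep⟩ := integrable_and_eq_one_add_mul_integral_slitDensityMeasure
    hF hF0 hbdry h1 h3 hα h4 hβ h5
  have hσ := ae_slitDensityMeasure_mem_Ioo Fplus
  have hσ1 : slitDensityMeasure Fplus univ ≤ 1 := measure_univ_le_one_of_limsup_nonneg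
    (hσ.mono fun t ht => Ioo_subset_Ioc_self ht) hid
    (fun x hx => hrep x (ofReal_mem_slitDomain_iff.2 hx)) h2
  have hα₀ : 0 ≤ 1 - (slitDensityMeasure Fplus).real univ :=
    sub_nonneg.2 (ENNReal.toReal_le_of_le_ofReal one_pos.le (by simpa using hσ1))
  have hmeas := isRepresentingMeasure_of_eq_one_add_mul_integral
    (hσ.mono fun t ht => Ioo_subset_Icc_self ht) hσ1 hrep
  rw [← slitMeasure_zero_right] at hmeas
  refine ⟨⟨hF.analyticOnNhd isOpen_slitDomain, _, hmeas⟩, _, hα₀, ?_, ?_, hmeas⟩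
  · simpa only [slitMeasure_real_singleton_zero hα₀] using hmeas.tendsto_atBot
  · simpa only [slitMeasure_real_singleton_one _ le_rfl, Complex.ofReal_zero]
      using hmeas.tendsto_one_sub_mul

theorem theorem2p5 (F Fplus : ℂ → ℂ) (U : Set ℂ)
    (hF : AnalyticOnNhd ℂ F slitDomain)
    (hF0 : F 0 = 1)
    -- `Fplus` is an analytic extension of `F` from the upper half-plane across `(1, +∞)`
    (hU : IsOpen U)
    (hUpper : upperHalf ⊆ U)
    (hSlit : ∀ x : ℝ, 1 < x → (x : ℂ) ∈ U)
    (hFplus : AnalyticOnNhd ℂ Fplus U)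
    (hext : ∀ z ∈ upperHalf, Fplus z = F z)
    (h1 : ∀ x : ℝ, x < 1 → (F x).im = 0)
    (h2 : (0 : EReal) ≤ limsup (fun x : ℝ => ((F x).re : EReal)) atBot)
    (h3 : ∀ x : ℝ, 1 < x → 0 ≤ (Fplus x).im)
    (h4 : ∃ α : ℝ, α < 1 ∧
      F =O[Bornology.cobounded ℂ ⊓ 𝓟 upperHalf] (fun z : ℂ => ‖z‖ ^ α))
    (h5 : ∃ α : ℝ, α < 1 ∧
      F =O[𝓝[upperHalf] (1 : ℂ)] (fun z : ℂ => ‖z - 1‖ ^ (-α))) :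
    F ∈ classT ∧
    ∃ α₀ α₁ : ℝ, 0 ≤ α₀ ∧ 0 ≤ α₁ ∧
      Tendsto (fun x : ℝ => F x) atBot (𝓝 (α₀ : ℂ)) ∧
      Tendsto (fun x : ℝ => (1 - (x : ℂ)) * F x) (𝓝[<] (1 : ℝ)) (𝓝 (α₁ : ℂ)) ∧
      IsRepresentingMeasure (slitMeasure α₀ α₁ Fplus) F := by
  have hbdry (x : ℝ) (hx : 1 < x) : Tendsto F (𝓝[upperHalf] (x : ℂ)) (𝓝 (Fplus x)) :=
    ((hFplus x (hSlit x hx)).continuousAt.tendsto.mono_left nhdsWithin_le_nhds).congr'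
      (eventually_mem_nhdsWithin.mono hext)
  obtain ⟨hT, α₀, hα₀, hbot, hone, hmeas⟩ :=
    theorem2p5_general hF.differentiableOn hF0 hbdry h1 h2 h3 h4 h5
  exact ⟨hT, α₀, 0, hα₀, le_rfl, hbot, hone, hmeas⟩
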